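/- Let $\mathcal H$ be a complex Hilbert space, let $k\ge 2$ be an integer with $k\le \dim\mathcal H$ ($\dim\mathcal H=\infty$ is allowed), and let $c=(c_1,\dots,c_k)\in\mathbb R^k$ with $c_1\ge\dots\ge c_k$ and not all $c_i$ equal. For a bounded linear operator $A$ on $\mathcal H$, let $$W_c(A)=\Big\{\sum_{j=1}^k c_j\langle Ae_j,e_j\rangle : \{e_1,\dots,e_k\}\text{ is an orthonormal subset of }\mathcal H\Big\}$$ be its $c$-numerical range. Put $\bar c_1=c_1$ and $\tilde c_k=c_k$ if $\dim\mathcal H=k$, and $\bar c_1=\max\{c_1,0\}$ and $\tilde c_k=\min\{c_k,0\}$ if $\dim\mathcal H>k$. Then for every nonzero bounded linear operator $A$ on $\mathcal H$ the following are equivalent: (1) $A$ has rank one. (2) For every bounded linear operator $B$ on $\mathcal H$ with $AB\neq 0$ there is $t_B\in\mathbb C$ such that $W_c(AB)$ is either a closed non-degenerate elliptical disk with foci $\bar c_1t_B$ and $\tilde c_kt_B$ (the foci may coincide, in which case it is a circular disk of positive radius), or a closed non-degenerate line segment (not a single point) with end points $\bar c_1t_B$ and $\tilde c_kt_B$. 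-/

import Mathlib

noncomputable section

namespace CNumRange

/-- The `c`-numerical range `W_c(A)` of a bounded operator `A` on a complex inner product space:
all sums `∑ j, c j * ⟨A e_j, e_j⟩` over orthonormal families `e_1, …, e_k`.
(Mathlib's inner product is linear in the second argument.) -/
def cNumericalRange {H : Type*} [NormedAddCommGroup H] [InnerProductSpace ℂ H] {k : ℕ}
    (c : Fin k → ℝ) (A : H →L[ℂ] H) : Set ℂ :=
  {z | ∃ e : Fin k → H, Orthonormal ℂ e ∧ z = ∑ j, (c j : ℂ) * inner ℂ (e j) (A (e j))}

open Classical in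
/-- `c̄_j`: equal to `c_j` if `dim H = k`, and to `max (c_j) 0` otherwise (i.e. if `dim H > k`). -/
def cBar (H : Type*) [NormedAddCommGroup H] [InnerProductSpace ℂ H] {k : ℕ}
    (c : Fin k → ℝ) (j : Fin k) : ℝ :=
  if Module.rank ℂ H = (k : Cardinal) then c j else max (c j) 0

open Classical in
/-- `c̃_j`: equal to `c_j` if `dim H = k`, and to `min (c_j) 0` otherwise (i.e. if `dim H > k`). -/
def cTilde (H : Type*) [NormedAddCommGroup H] [InnerProductSpace ℂ H] {k : ℕ}
    (c : Fin k → ℝ) (j : Fin k) : ℝ :=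
  if Module.rank ℂ H = (k : Cardinal) then c j else min (c j) 0

/-- `S` is a (closed, non-degenerate) elliptical disk in the plane with foci `p` and `q`:
the points whose distances to the foci add up to at most the length `2 * a` of the major axis,
which exceeds the distance of the foci. The foci may coincide (a circular disk). -/
def IsEllipticalDisk (S : Set ℂ) (p q : ℂ) : Prop :=
  ∃ a : ℝ, dist p q < 2 * a ∧ S = {z | dist z p + dist z q ≤ 2 * a}

/-- `S` is a (closed, non-degenerate) line segment with end points `p` and `q`. -/
def IsLineSegment (S : Set ℂ) (p q : ℂ) : Prop :=
  p ≠ q ∧ S = segment ℝ p q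

end CNumRange

end

namespace CNumRange

/-! Write M = c̄₁, m = c̃ₖ; then m < M. If A has rank one, a nonzero AB is x ↦ ⟪v, x⟫ u with u, v ≠
0. With t = ⟪v, u⟫, its c-numerical range is exactly {z : |z - M t| + |z - m t| ≤ (M - m)‖u‖‖v‖}
(`cNumericalRange_rankOne`). Cauchy–Schwarz, |t| ≤ ‖u‖‖v‖, makes this an elliptical disk when strict
and the segment between the foci when an equality. The inclusion ⊆ is a weighted Cauchy–Schwarz
estimate (`norm_sub_add_norm_sub_le`); ⊇ reduces to the elliptical range theorem for rank one
operators, by putting all of u into the two vectors that carry the weights M and m.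

If A has rank at least two, its range contains an orthonormal pair e, f, and B can be chosen so that
AB is diagonal on e, f with eigenvalues 1, l and zero on the complement. For dim H = k = 2 the
choice l = 1 gives the identity, whose range is a point. Otherwise l = i gives a range inside the
quadrant re ≤ M, im ≥ m that contains its corner, another point on one of its edges, and points that
are not collinear. Strict convexity excludes a disk, and non-collinearity a segment. -/

variable {H : Type*} [NormedAddCommGroup H] [InnerProductSpace ℂ H]

/-! ### Extension of orthonormal families -/

open Module in
/-- An orthonormal family on a subset of a finite index set of cardinality at most the dimension
extends to an orthonormal family on the whole index set. -/
theorem exists_orthonormal_extension {ι : Type*} [Fintype ι]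
    (hι : (Fintype.card ι : Cardinal) ≤ Module.rank ℂ H) (s : Set ι) (v : ι → H)
    (hv : Orthonormal ℂ (s.domRestrict v)) :
    ∃ g : ι → H, Orthonormal ℂ g ∧ ∀ i ∈ s, g i = v i := by
  classical
  obtain ⟨w, hw⟩ := Module.le_rank_iff.1 hι
  let V : Submodule ℂ H := Submodule.span ℂ (Set.range v ∪ Set.range w)
  have : FiniteDimensional ℂ V :=
    FiniteDimensional.span_of_finite ℂ ((Set.finite_range v).union (Set.finite_range w))
  have hvV (i : ι) : v i ∈ V := Submodule.subset_span (Or.inl ⟨i, rfl⟩)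
  have hwV (i) : w i ∈ V := Submodule.subset_span (Or.inr ⟨i, rfl⟩)
  have hw' : LinearIndependent ℂ (fun i => (⟨w i, hwV i⟩ : V)) :=
    LinearIndependent.of_comp V.subtype hw
  have hcard : Fintype.card ι ≤ finrank ℂ V := by
    simpa using hw'.fintype_card_le_finrank
  -- Padding the index set by `Fin N` makes its size equal to dim V, so that the prescribed vectors
  -- extend to an orthonormal basis of V.
  let N := finrank ℂ V - Fintype.card ι
  let v' : ι ⊕ Fin N → V := Sum.elim (fun i => ⟨v i, hvV i⟩) 0
  have hN : finrank ℂ V = Fintype.card (ι ⊕ Fin N) := by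
    simp [N]; omega
  have hv' : Orthonormal ℂ ((Sum.inl '' s).domRestrict v') := by
    rw [orthonormal_iff_ite] at hv ⊢
    rintro ⟨_, i, hi, rfl⟩ ⟨_, j, hj, rfl⟩
    simpa [v', Subtype.ext_iff] using hv ⟨i, hi⟩ ⟨j, hj⟩
  obtain ⟨b, hb⟩ := hv'.exists_orthonormalBasis_extension_of_card_eq hN
  refine ⟨fun i => b (Sum.inl i), ?_, fun i hi => ?_⟩
  · exact (b.orthonormal.comp Sum.inl Sum.inl_injective).comp_linearIsometry V.subtypeₗᵢ
  · change ((b (Sum.inl i) : V) : H) = v i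
    rw [hb _ ⟨i, hi, rfl⟩]
    rfl

/-- An orthonormal pair extends to an orthonormal family, at prescribed places. -/
theorem exists_orthonormal_extension_pair {ι : Type*} [Fintype ι]
    (hι : (Fintype.card ι : Cardinal) ≤ Module.rank ℂ H) {a b : ι} (hab : a ≠ b) {e f : H}
    (he : ‖e‖ = 1) (hf : ‖f‖ = 1) (hef : inner ℂ e f = 0) :
    ∃ g : ι → H, Orthonormal ℂ g ∧ g a = e ∧ g b = f := by
  classical
  have hfe : inner ℂ f e = 0 := inner_eq_zero_symm.1 hef
  obtain ⟨g, hg, hgv⟩ := exists_orthonormal_extension hι {a, b} (fun i => if i = a then e else f) (by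
    rw [orthonormal_iff_ite]
    rintro ⟨i, rfl | rfl⟩ ⟨j, rfl | rfl⟩ <;>
      simp [hab, hab.symm, Subtype.ext_iff, hef, hfe, inner_self_eq_norm_sq_to_K, he, hf])
  exact ⟨g, hg, by simpa using hgv a (by simp), by simpa [hab.symm] using hgv b (by simp)⟩

/-- For a unit vector there is an orthogonal unit vector, if the dimension is at least two. -/
theorem exists_unit_orthogonal (h2 : (2 : Cardinal) ≤ Module.rank ℂ H) {u : H} (hu : ‖u‖ = 1) :
    ∃ g : H, ‖g‖ = 1 ∧ inner ℂ u g = 0 := by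
  obtain ⟨g, hg, hg0⟩ := exists_orthonormal_extension (ι := Fin 2) (by simpa using h2) {0}
    (fun _ => u) (by
      rw [orthonormal_iff_ite]
      rintro ⟨i, rfl⟩ ⟨j, rfl⟩
      simp [inner_self_eq_norm_sq_to_K, hu])
  refine ⟨g 1, hg.1 1, ?_⟩
  rw [← hg0 0 rfl]
  exact hg.2 (by simp)

/-- Existence of an orthonormal pair in dimension at least two. -/
theorem exists_orthonormal_pair (h2 : (2 : Cardinal) ≤ Module.rank ℂ H) :
    ∃ e f : H, ‖e‖ = 1 ∧ ‖f‖ = 1 ∧ inner ℂ e f = 0 := by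
  obtain ⟨g, hg, -⟩ := exists_orthonormal_extension (ι := Fin 2) (H := H) (by simpa using h2) ∅
    (fun _ => 0) (by rw [orthonormal_iff_ite]; rintro ⟨i, hi⟩; exact hi.elim)
  exact ⟨g 0, g 1, hg.1 0, hg.1 1, hg.2 (by simp)⟩

/-! ### The elliptical range theorem in rank one -/

/-- The elliptical range theorem for operators of rank one, in normalized form. -/
theorem exists_rankOne_value_of_unit {w t : ℂ} (h : ‖w‖ + ‖w - t‖ ≤ 1) :
    ∃ (x : ℝ) (y : ℂ), x ^ 2 + ‖y‖ ^ 2 = 1 ∧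
      w = t * x ^ 2 + Real.sqrt (1 - ‖t‖ ^ 2) * (x * y) := by
  set a := ‖w‖ with ha
  set b := ‖w - t‖ with hb
  have ha0 : 0 ≤ a := norm_nonneg _
  have hb0 : 0 ≤ b := norm_nonneg _
  have ht : ‖t‖ ≤ 1 := by
    have := norm_sub_le w (w - t)
    rw [sub_sub_cancel] at this
    linarith
  -- With p = x², a suitable y exists once |w - t p|² = (1 - |t|²) p (1 - p), which simplifies to p²
  -- - 2 p₀ p + a² = 0. The hypothesis a + b ≤ 1 gives a ≤ p₀ ≤ 1, so the smaller root is real and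
  -- lies in [0, 1].
  set p₀ := (1 + a ^ 2 - b ^ 2) / 2 with hp₀
  have hap : a ≤ p₀ := by nlinarith
  have hp1 : p₀ ≤ 1 := by nlinarith
  set d := Real.sqrt (p₀ ^ 2 - a ^ 2) with hd
  have hd0 : 0 ≤ d := Real.sqrt_nonneg _
  have hd2 : d ^ 2 = p₀ ^ 2 - a ^ 2 := Real.sq_sqrt (by nlinarith)
  set p := p₀ - d with hp
  have hp_nonneg : 0 ≤ p := by
    have : d ≤ p₀ := by
      rw [hd]; exact Real.sqrt_le_iff.2 ⟨by linarith, by nlinarith⟩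
    linarith
  have hp_le : p ≤ 1 := by linarith
  have hroot : p ^ 2 - 2 * p₀ * p + a ^ 2 = 0 := by rw [hp]; linear_combination hd2
  set σ := Real.sqrt (1 - ‖t‖ ^ 2) with hσ
  have hσ2 : σ ^ 2 = 1 - ‖t‖ ^ 2 := Real.sq_sqrt (by nlinarith [norm_nonneg t])
  set x := Real.sqrt p with hx
  have hx2 : x ^ 2 = p := Real.sq_sqrt hp_nonneg
  set s := Real.sqrt (1 - p) with hs
  have hs2 : s ^ 2 = 1 - p := Real.sq_sqrt (by linarith)
  have hnorm : ‖w - t * (p : ℂ)‖ ^ 2 = (σ * x * s) ^ 2 := by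
    have h1 : a ^ 2 = w.re ^ 2 + w.im ^ 2 := by rw [ha, ← Complex.normSq_eq_norm_sq, Complex.normSq_apply]; ring
    have h2 : b ^ 2 = (w.re - t.re) ^ 2 + (w.im - t.im) ^ 2 := by
      rw [hb, ← Complex.normSq_eq_norm_sq, Complex.normSq_apply, Complex.sub_re, Complex.sub_im]; ring
    have h3 : ‖t‖ ^ 2 = t.re ^ 2 + t.im ^ 2 := by rw [← Complex.normSq_eq_norm_sq, Complex.normSq_apply]; ring
    have h4 : ‖w - t * (p : ℂ)‖ ^ 2 = (w.re - t.re * p) ^ 2 + (w.im - t.im * p) ^ 2 := by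
      rw [← Complex.normSq_eq_norm_sq, Complex.normSq_apply]; simp; ring
    rw [h4, mul_pow, mul_pow, hσ2, hx2, hs2, h3]
    have h5 : 2 * p₀ = 1 + a ^ 2 - b ^ 2 := by rw [hp₀]; ring
    rw [h5, h2] at hroot
    linear_combination hroot + (p - 1) * h1
  have hnorm' : ‖w - t * (p : ℂ)‖ = σ * x * s :=
    (pow_left_inj₀ (norm_nonneg _) (by positivity) two_ne_zero).1 hnorm
  -- If σ x = 0 then w = t p already, and any y of the right modulus will do.
  by_cases h0 : σ * x = 0
  · refine ⟨x, s, ?_, ?_⟩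
    · rw [Complex.norm_real, Real.norm_eq_abs, sq_abs, hx2, hs2]; ring
    · have hw : w - t * (p : ℂ) = 0 := by rw [← norm_eq_zero, hnorm', h0, zero_mul]
      have h0' : (σ : ℂ) * x = 0 := by exact_mod_cast h0
      have hx2' : (x : ℂ) ^ 2 = p := by exact_mod_cast hx2
      rw [hx2']
      linear_combination hw - s * h0'
  · have h0' : (σ : ℂ) * x ≠ 0 := by exact_mod_cast h0
    refine ⟨x, (w - t * p) / (σ * x), ?_, ?_⟩
    · have : ‖(σ : ℂ) * x‖ = σ * x := by
        rw [norm_mul, Complex.norm_real, Complex.norm_real, Real.norm_of_nonneg (by positivity),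
          Real.norm_of_nonneg (by positivity)]
      rw [norm_div, hnorm', this, mul_div_cancel_left₀ _ h0, hx2, hs2]; ring
    · have hx2' : (x : ℂ) ^ 2 = p := by exact_mod_cast hx2
      rw [hx2', ← mul_assoc, mul_div_cancel₀ _ h0']; ring

/-- The elliptical range theorem for the rank one operator `x ↦ ⟪v, x⟫ u` with unit vectors
`u`, `v`. -/
theorem exists_orthonormal_pair_rankOne_value_of_unit (h2 : (2 : Cardinal) ≤ Module.rank ℂ H)
    {u v : H} (hu : ‖u‖ = 1) (hv : ‖v‖ = 1) {w : ℂ} (hw : ‖w‖ + ‖w - inner ℂ v u‖ ≤ 1) :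
    ∃ e f : H, ‖e‖ = 1 ∧ ‖f‖ = 1 ∧ inner ℂ e f = 0 ∧
      u = inner ℂ e u • e + inner ℂ f u • f ∧ inner ℂ v e * inner ℂ e u = w := by
  obtain ⟨x, y, hxy, hwxy⟩ := exists_rankOne_value_of_unit hw
  set t : ℂ := inner ℂ v u with ht
  have huu : inner ℂ u u = (1 : ℂ) := by simp [inner_self_eq_norm_sq_to_K, hu]
  have huv : inner ℂ u v = starRingEnd ℂ t := by rw [ht, inner_conj_symm]
  set v₀ := v - starRingEnd ℂ t • u with hv₀
  have huv₀ : inner ℂ u v₀ = 0 := by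
    rw [hv₀, inner_sub_right, inner_smul_right, huv, huu]; ring
  have hnv₀ : ‖v₀‖ ^ 2 = 1 - ‖t‖ ^ 2 := by
    have h : v = v₀ + starRingEnd ℂ t • u := by rw [hv₀]; abel
    have h' := norm_add_sq_eq_norm_sq_add_norm_sq_of_inner_eq_zero v₀ (starRingEnd ℂ t • u)
      (by rw [inner_smul_right, inner_eq_zero_symm.1 huv₀, mul_zero])
    rw [← h, norm_smul, hv, hu, RCLike.norm_conj] at h'
    linarith
  have hσ : Real.sqrt (1 - ‖t‖ ^ 2) = ‖v₀‖ := by rw [← hnv₀, Real.sqrt_sq (norm_nonneg _)]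
  rw [hσ] at hwxy
  -- In the orthonormal pair u, g one has v = conj t • u + ‖v₀‖ • g; if v₀ = 0, any unit g
  -- orthogonal to u serves. The pair e, f is then the unitary rotation of u, g with first vector x
  -- u + y g.
  obtain ⟨g, hg, hug, hvg⟩ : ∃ g : H, ‖g‖ = 1 ∧ inner ℂ u g = 0 ∧ v₀ = (‖v₀‖ : ℂ) • g := by
    by_cases h0 : v₀ = 0
    · obtain ⟨g, hg, hug⟩ := exists_unit_orthogonal h2 hu
      exact ⟨g, hg, hug, by simp [h0]⟩
    · have h0' : (‖v₀‖ : ℂ) ≠ 0 := by exact_mod_cast norm_ne_zero_iff.2 h0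
      refine ⟨(‖v₀‖ : ℂ)⁻¹ • v₀, norm_smul_inv_norm h0, by rw [inner_smul_right, huv₀, mul_zero], ?_⟩
      rw [smul_smul, mul_inv_cancel₀ h0', one_smul]
  have hgg : inner ℂ g g = (1 : ℂ) := by simp [inner_self_eq_norm_sq_to_K, hg]
  have hgu : inner ℂ g u = 0 := inner_eq_zero_symm.1 hug
  have hvg' : inner ℂ v g = (‖v₀‖ : ℂ) := by
    have h : v = (‖v₀‖ : ℂ) • g + starRingEnd ℂ t • u := by rw [← hvg, hv₀]; abel
    rw [h, inner_add_left, inner_smul_left, inner_smul_left, hug, hgg, Complex.conj_ofReal]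
    simp
  have hxy' : (x : ℂ) ^ 2 + starRingEnd ℂ y * y = 1 := by
    rw [mul_comm, Complex.mul_conj, Complex.normSq_eq_norm_sq]
    exact_mod_cast hxy
  have heu : inner ℂ ((x : ℂ) • u + y • g) u = (x : ℂ) := by
    rw [inner_add_left, inner_smul_left, inner_smul_left, huu, hgu, Complex.conj_ofReal]; ring
  have hfu : inner ℂ (-(starRingEnd ℂ y) • u + (x : ℂ) • g) u = -y := by
    rw [inner_add_left, inner_smul_left, inner_smul_left, huu, hgu, map_neg, Complex.conj_conj]; ring
  have hunit (z : H) (hz : inner ℂ z z = (1 : ℂ)) : ‖z‖ = 1 := by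
    rw [inner_self_eq_norm_sq_to_K] at hz
    have hz' : (‖z‖ : ℂ) ^ 2 = 1 := hz
    exact (pow_eq_one_iff_of_nonneg (norm_nonneg z) two_ne_zero).1 (by exact_mod_cast hz')
  refine ⟨(x : ℂ) • u + y • g, -(starRingEnd ℂ y) • u + (x : ℂ) • g, hunit _ ?_, hunit _ ?_, ?_,
    ?_, ?_⟩
  · simp only [inner_add_left, inner_smul_left, inner_add_right, inner_smul_right, huu, hgg, hug,
      hgu, Complex.conj_ofReal]
    linear_combination hxy'
  · simp only [inner_add_left, inner_smul_left, inner_add_right, inner_smul_right, huu, hgg, hug,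
      hgu, Complex.conj_ofReal, map_neg, Complex.conj_conj]
    linear_combination hxy'
  · simp only [inner_add_left, inner_smul_left, inner_add_right, inner_smul_right, huu, hgg, hug,
      hgu, Complex.conj_ofReal]
    ring
  · rw [heu, hfu]
    have : (x : ℂ) • ((x : ℂ) • u + y • g) + -y • (-(starRingEnd ℂ y) • u + (x : ℂ) • g)
        = ((x : ℂ) ^ 2 + starRingEnd ℂ y * y) • u := by module
    rw [this, hxy', one_smul]
  · rw [heu, inner_add_right, inner_smul_right, inner_smul_right, hvg', hwxy]
    ring

/-- The elliptical range theorem for the rank one operator `x ↦ ⟪v, x⟫ u`. -/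
theorem exists_orthonormal_pair_rankOne_value (h2 : (2 : Cardinal) ≤ Module.rank ℂ H)
    {u v : H} (hu : u ≠ 0) (hv : v ≠ 0) {w : ℂ} (hw : ‖w‖ + ‖w - inner ℂ v u‖ ≤ ‖u‖ * ‖v‖) :
    ∃ e f : H, ‖e‖ = 1 ∧ ‖f‖ = 1 ∧ inner ℂ e f = 0 ∧
      u = inner ℂ e u • e + inner ℂ f u • f ∧ inner ℂ v e * inner ℂ e u = w := by
  have hu0 : (‖u‖ : ℂ) ≠ 0 := by exact_mod_cast norm_ne_zero_iff.2 hu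
  have hv0 : (‖v‖ : ℂ) ≠ 0 := by exact_mod_cast norm_ne_zero_iff.2 hv
  obtain ⟨u₁, hu₁⟩ : ∃ x, x = (‖u‖ : ℂ)⁻¹ • u := ⟨_, rfl⟩
  obtain ⟨v₁, hv₁⟩ : ∃ x, x = (‖v‖ : ℂ)⁻¹ • v := ⟨_, rfl⟩
  have huu₁ : u = (‖u‖ : ℂ) • u₁ := by rw [hu₁, smul_smul, mul_inv_cancel₀ hu0, one_smul]
  have hvv₁ : v = (‖v‖ : ℂ) • v₁ := by rw [hv₁, smul_smul, mul_inv_cancel₀ hv0, one_smul]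
  have hr : 0 < ‖u‖ * ‖v‖ := mul_pos (norm_pos_iff.2 hu) (norm_pos_iff.2 hv)
  have hnr : ‖(‖u‖ * ‖v‖ : ℂ)‖ = ‖u‖ * ‖v‖ := by simp
  have hin : inner ℂ v₁ u₁ = inner ℂ v u / (‖u‖ * ‖v‖) := by
    rw [hu₁, hv₁, inner_smul_left, inner_smul_right, map_inv₀, Complex.conj_ofReal]
    field_simp
  obtain ⟨e, f, he, hf, hef, hue, hve⟩ := exists_orthonormal_pair_rankOne_value_of_unit h2
    (u := u₁) (v := v₁) (by rw [hu₁]; exact norm_smul_inv_norm hu) (by rw [hv₁]; exact norm_smul_inv_norm hv)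
    (w := w / (‖u‖ * ‖v‖)) (by
      rw [hin, ← sub_div, norm_div, norm_div, hnr, ← add_div]
      exact (div_le_one hr).2 hw)
  refine ⟨e, f, he, hf, hef, ?_, ?_⟩
  · have h := congrArg (fun z => (‖u‖ : ℂ) • z) hue
    simp only [smul_add, smul_smul] at h
    rw [← huu₁] at h
    rwa [← inner_smul_right, ← inner_smul_right, ← huu₁] at h
  · rw [huu₁, hvv₁, inner_smul_left, inner_smul_right, Complex.conj_ofReal]
    rw [eq_div_iff (mul_ne_zero hu0 hv0)] at hve
    linear_combination hve

/-! ### The outer estimate: values lie in the ellipse -/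

/-- The values `∑ j, c j ⟪v, e j⟫ ⟪e j, u⟫` lie in the elliptical disk with foci `M ⟪v, u⟫` and
`m ⟪v, u⟫` and major axis `(M - m) ‖u‖ ‖v‖`. -/
theorem norm_sub_add_norm_sub_le {ι : Type*} [Fintype ι] {e : ι → H} (he : Orthonormal ℂ e)
    {c : ι → ℝ} {m M : ℝ} (hm : ∀ j, m ≤ c j) (hM : ∀ j, c j ≤ M) (hmM : m ≤ M)
    (h : (m ≤ 0 ∧ 0 ≤ M) ∨ ∀ x, (∀ j, inner ℂ (e j) x = 0) → x = 0) (u v : H) :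
    ‖(∑ j, (c j : ℂ) * (inner ℂ v (e j) * inner ℂ (e j) u)) - M * inner ℂ v u‖ +
      ‖(∑ j, (c j : ℂ) * (inner ℂ v (e j) * inner ℂ (e j) u)) - m * inner ℂ v u‖
        ≤ (M - m) * (‖u‖ * ‖v‖) := by
  let π (x : H) : H := ∑ j, inner ℂ (e j) x • e j
  have hπ (x : H) (j) : inner ℂ (e j) (x - π x) = 0 := by
    rw [inner_sub_right, he.inner_right_fintype, sub_self]
  have hππ (x y : H) : inner ℂ (π x) (y - π y) = 0 := by
    simp only [π, sum_inner, inner_smul_left]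
    exact Finset.sum_eq_zero fun j _ => by rw [hπ, mul_zero]
  have hnorm (x : H) : ‖x‖ ^ 2 = ∑ j, ‖inner ℂ (e j) x‖ ^ 2 + ‖x - π x‖ ^ 2 := by
    have h1 := norm_add_sq_eq_norm_sq_add_norm_sq_of_inner_eq_zero (π x) (x - π x) (hππ x x)
    rw [add_sub_cancel] at h1
    have h2 : ‖π x‖ ^ 2 = ∑ j, ‖inner ℂ (e j) x‖ ^ 2 := by
      have h3 : ((‖π x‖ : ℂ)) ^ 2 = ∑ j, (‖inner ℂ (e j) x‖ : ℂ) ^ 2 := by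
        have := inner_self_eq_norm_sq_to_K (𝕜 := ℂ) (π x)
        refine this.symm.trans ((he.inner_sum _ _ _).trans ?_)
        exact Finset.sum_congr rfl fun j _ => by
          rw [mul_comm, Complex.mul_conj, Complex.normSq_eq_norm_sq]; push_cast; rfl
      exact_mod_cast h3
    nlinarith
  set α : ι → ℂ := fun j => inner ℂ v (e j) with hα
  set β : ι → ℂ := fun j => inner ℂ (e j) u with hβ
  -- δ is the part of ⟪v, u⟫ not seen by the family e; it acts like one more term, of weight 0.
  set δ : ℂ := inner ℂ (v - π v) (u - π u) with hδ
  have hδt : inner ℂ v u = ∑ j, α j * β j + δ := by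
    rw [hδ, inner_sub_left, hππ, sub_zero, inner_sub_right]
    simp only [π, inner_sum, inner_smul_right]
    rw [Finset.sum_congr rfl fun j _ => mul_comm _ _]
    ring
  have hX : (∑ j, ‖α j‖ * ‖β j‖) ^ 2 ≤ (∑ j, ‖α j‖ ^ 2) * ∑ j, ‖β j‖ ^ 2 :=
    Finset.sum_mul_sq_le_sq_mul_sq _ _ _
  have hY : ‖δ‖ ≤ ‖v - π v‖ * ‖u - π u‖ := norm_inner_le_norm _ _
  have hu := hnorm u
  have hv := hnorm v
  have hαv : ∑ j, ‖inner ℂ (e j) v‖ ^ 2 = ∑ j, ‖α j‖ ^ 2 :=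
    Finset.sum_congr rfl fun j _ => by rw [hα, norm_inner_symm]
  rw [hαv] at hv
  have hsum : ∑ j, ‖α j‖ * ‖β j‖ + ‖δ‖ ≤ ‖u‖ * ‖v‖ := by
    set X := ∑ j, ‖α j‖ * ‖β j‖
    set A := ∑ j, ‖α j‖ ^ 2
    set B := ∑ j, ‖β j‖ ^ 2
    have hX0 : 0 ≤ X := Finset.sum_nonneg fun j _ => by positivity
    have hA0 : 0 ≤ A := Finset.sum_nonneg fun j _ => by positivity
    have hB0 : 0 ≤ B := Finset.sum_nonneg fun j _ => by positivity
    set p := ‖v - π v‖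
    set q := ‖u - π u‖
    have hp : 0 ≤ p := norm_nonneg _
    have hq : 0 ≤ q := norm_nonneg _
    refine (add_le_add_right hY X).trans (abs_le_of_sq_le_sq' ?_ (by positivity)).2
    -- AM–GM applied to X² ≤ A B; this is Cauchy–Schwarz for the plane vectors (√A, p) and (√B, q).
    have hcross : 2 * (X * (p * q)) ≤ A * q ^ 2 + B * p ^ 2 := by
      refine (abs_le_of_sq_le_sq' ?_ (by positivity)).2
      have : X ^ 2 * (p ^ 2 * q ^ 2) ≤ A * B * (p ^ 2 * q ^ 2) :=
        mul_le_mul_of_nonneg_right hX (by positivity)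
      nlinarith [sq_nonneg (A * q ^ 2 - B * p ^ 2)]
    rw [mul_pow, hu, hv]
    nlinarith
  have hMm : ‖(M : ℂ) * δ‖ + ‖(m : ℂ) * δ‖ ≤ (M - m) * ‖δ‖ := by
    rcases h with ⟨hm0, hM0⟩ | h
    · rw [norm_mul, norm_mul, Complex.norm_real, Complex.norm_real, Real.norm_of_nonneg hM0,
        Real.norm_of_nonpos hm0]
      linarith
    · have : δ = 0 := by rw [hδ, h _ (hπ u), inner_zero_right]
      simp [this]
  have hb (N : ℝ) : ‖(∑ j, (c j : ℂ) * (α j * β j)) - N * inner ℂ v u‖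
      ≤ ∑ j, |c j - N| * (‖α j‖ * ‖β j‖) + ‖(N : ℂ) * δ‖ := by
    have : (∑ j, (c j : ℂ) * (α j * β j)) - N * inner ℂ v u
        = ∑ j, ((c j - N : ℝ) : ℂ) * (α j * β j) - N * δ := by
      rw [hδt, mul_add, Finset.mul_sum, ← sub_sub, ← Finset.sum_sub_distrib]
      congr 1
      exact Finset.sum_congr rfl fun j _ => by push_cast; ring
    rw [this]
    refine (norm_sub_le _ _).trans (add_le_add_left ((norm_sum_le _ _).trans_eq ?_) _)
    exact Finset.sum_congr rfl fun j _ => by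
      rw [norm_mul, norm_mul, Complex.norm_real, Real.norm_eq_abs]
  -- Each weight in [m, M] satisfies |c j - M| + |c j - m| = M - m, so both distances together cost
  -- M - m times the total mass.
  calc _ ≤ (∑ j, |c j - M| * (‖α j‖ * ‖β j‖) + ‖(M : ℂ) * δ‖) +
        (∑ j, |c j - m| * (‖α j‖ * ‖β j‖) + ‖(m : ℂ) * δ‖) := add_le_add (hb M) (hb m)
    _ = (M - m) * (∑ j, ‖α j‖ * ‖β j‖) + (‖(M : ℂ) * δ‖ + ‖(m : ℂ) * δ‖) := by
      rw [add_add_add_comm, ← Finset.sum_add_distrib, Finset.mul_sum]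
      congr 1
      refine Finset.sum_congr rfl fun j _ => ?_
      rw [abs_of_nonpos (sub_nonpos.2 (hM j)), abs_of_nonneg (sub_nonneg.2 (hm j))]
      ring
    _ ≤ (M - m) * (∑ j, ‖α j‖ * ‖β j‖) + (M - m) * ‖δ‖ := by gcongr
    _ ≤ (M - m) * (‖u‖ * ‖v‖) := by
      rw [← mul_add]
      exact mul_le_mul_of_nonneg_left hsum (sub_nonneg.2 hmM)

/-- An orthonormal family whose cardinality is the dimension is complete. -/
theorem eq_zero_of_orthonormal_of_rank_eq {k : ℕ} (h : Module.rank ℂ H = (k : Cardinal))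
    {e : Fin k → H} (he : Orthonormal ℂ e) (x : H) (hx : ∀ j, inner ℂ (e j) x = 0) : x = 0 := by
  have hfin : Module.finrank ℂ H = k := Module.finrank_eq_of_rank_eq h
  have : FiniteDimensional ℂ H := 
    Module.rank_lt_aleph0_iff.1 (h ▸ Cardinal.natCast_lt_aleph0)
  have hspan := he.linearIndependent.span_eq_top_of_card_eq_finrank' (by simp [hfin])
  have hmem : x ∈ Submodule.span ℂ (Set.range e) := by rw [hspan]; trivial
  have : inner ℂ x x = (0 : ℂ) := by
    refine Submodule.span_induction (p := fun y _ => inner ℂ y x = (0 : ℂ)) ?_ ?_ ?_ ?_ hmem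
    · rintro _ ⟨j, rfl⟩; exact hx j
    · exact inner_zero_left _
    · intro y z _ _ hy hz; rw [inner_add_left, hy, hz, add_zero]
    · intro a y _ hy; rw [inner_smul_left, hy, mul_zero]
  exact inner_self_eq_zero.1 this

/-! ### Extreme weights and the range of a rank one operator -/

section Weights

theorem pos_of_two_le {k : ℕ} (hk : 2 ≤ k) : 0 < k := by lia

theorem sub_one_lt_of_two_le {k : ℕ} (hk : 2 ≤ k) : k - 1 < k := by lia

variable {k : ℕ} {c : Fin k → ℝ}

theorem le_apply_zero (hk : 2 ≤ k) (hc : Antitone c) (j : Fin k) : c j ≤ c ⟨0, pos_of_two_le hk⟩ :=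
  hc (Fin.mk_le_of_le_val (Nat.zero_le _))

theorem apply_last_le (hk : 2 ≤ k) (hc : Antitone c) (j : Fin k) : c ⟨k - 1, sub_one_lt_of_two_le hk⟩ ≤ c j :=
  hc (Fin.le_def.2 (Nat.le_sub_one_of_lt j.2))

theorem apply_le_cBar (hk : 2 ≤ k) (hc : Antitone c) (j : Fin k) : c j ≤ cBar H c ⟨0, pos_of_two_le hk⟩ := by
  unfold cBar
  split_ifs
  · exact le_apply_zero hk hc j
  · exact (le_apply_zero hk hc j).trans (le_max_left _ _)

theorem cTilde_le_apply (hk : 2 ≤ k) (hc : Antitone c) (j : Fin k) : cTilde H c ⟨k - 1, sub_one_lt_of_two_le hk⟩ ≤ c j := by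
  unfold cTilde
  split_ifs
  · exact apply_last_le hk hc j
  · exact (min_le_left _ _).trans (apply_last_le hk hc j)

theorem cTilde_lt_cBar (hk : 2 ≤ k) (hc : Antitone c) (hne : ∃ i j, c i ≠ c j) :
    cTilde H c ⟨k - 1, sub_one_lt_of_two_le hk⟩ < cBar H c ⟨0, pos_of_two_le hk⟩ := by
  obtain ⟨i, j, hij⟩ := hne
  have h1 := apply_le_cBar (H := H) hk hc
  have h2 := cTilde_le_apply (H := H) hk hc
  rcases lt_or_gt_of_ne hij with h | h
  · exact ((h2 i).trans_lt h).trans_le (h1 j)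
  · exact ((h2 j).trans_lt h).trans_le (h1 i)

/-- If dim H ≠ k, the zero in the max and min separates the two extreme values; if dim H = k,
nothing is left outside the family. This is the alternative required by `norm_sub_add_norm_sub_le`.
-/
theorem cTilde_nonpos_and_cBar_nonneg_or_complete (hk : 2 ≤ k) {e : Fin k → H}
    (he : Orthonormal ℂ e) :
    (cTilde H c ⟨k - 1, sub_one_lt_of_two_le hk⟩ ≤ 0 ∧ 0 ≤ cBar H c ⟨0, pos_of_two_le hk⟩) ∨
      ∀ x, (∀ j, inner ℂ (e j) x = 0) → x = 0 := by
  by_cases h : Module.rank ℂ H = (k : Cardinal)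
  · exact Or.inr (eq_zero_of_orthonormal_of_rank_eq h he)
  · left
    simp [cTilde, cBar, h]

/-- If `dim H > k`, one may adjoin a zero to the weights. In all cases there are weights that
attain the extreme values `c̄₁` and `c̃ₖ`. -/
theorem exists_extended_weights (hk : 2 ≤ k) (hdim : (k : Cardinal) ≤ Module.rank ℂ H)
    (hc : Antitone c) :
    ∃ (n : ℕ) (c' : Fin n → ℝ) (a b : Fin n), (n : Cardinal) ≤ Module.rank ℂ H ∧
      c' a = cBar H c ⟨0, pos_of_two_le hk⟩ ∧ c' b = cTilde H c ⟨k - 1, sub_one_lt_of_two_le hk⟩ ∧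
      (∀ T : H →L[ℂ] H, cNumericalRange c' T ⊆ cNumericalRange c T) ∧
      ((Module.rank ℂ H = (2 : ℕ) ∧ k = 2) ∨ 3 ≤ n) := by
  by_cases h : Module.rank ℂ H = (k : Cardinal)
  · refine ⟨k, c, ⟨0, pos_of_two_le hk⟩, ⟨k - 1, sub_one_lt_of_two_le hk⟩, hdim, by simp [cBar, h], by simp [cTilde, h],
      fun T => subset_rfl, ?_⟩
    rcases hk.eq_or_lt with rfl | h3
    · exact Or.inl ⟨h, rfl⟩
    · exact Or.inr h3
  · have hlt : ((k + 1 : ℕ) : Cardinal) ≤ Module.rank ℂ H := by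
      rw [Nat.cast_add, Nat.cast_one]
      exact Cardinal.add_one_le_of_lt (lt_of_le_of_ne hdim (Ne.symm h))
    refine ⟨k + 1, Fin.cons 0 c,
      if 0 ≤ c ⟨0, pos_of_two_le hk⟩ then Fin.succ ⟨0, pos_of_two_le hk⟩ else 0,
      if c ⟨k - 1, sub_one_lt_of_two_le hk⟩ ≤ 0 then Fin.succ ⟨k - 1, sub_one_lt_of_two_le hk⟩ else 0, hlt, ?_, ?_, ?_,
      Or.inr (by omega)⟩
    · simp only [cBar, h, if_false]
      split_ifs with h0
      · rw [Fin.cons_succ, max_eq_left h0]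
      · rw [Fin.cons_zero, max_eq_right (le_of_not_ge h0)]
    · simp only [cTilde, h, if_false]
      split_ifs with h0
      · rw [Fin.cons_succ, min_eq_left h0]
      · rw [Fin.cons_zero, min_eq_right (le_of_not_ge h0)]
    -- Dropping the vector of weight 0 does not change the sum.
    · rintro T _ ⟨e, he, rfl⟩
      refine ⟨e ∘ Fin.succ, he.comp _ (Fin.succ_injective _), ?_⟩
      simp [Fin.sum_univ_succ]

/-- The `c`-numerical range of the rank one operator `x ↦ ⟪v, x⟫ u`. -/
theorem cNumericalRange_rankOne (hk : 2 ≤ k) (hdim : (k : Cardinal) ≤ Module.rank ℂ H)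
    (hc : Antitone c) (hne : ∃ i j, c i ≠ c j) {R : H →L[ℂ] H} {u v : H} (hu : u ≠ 0) (hv : v ≠ 0)
    (hR : ∀ x, R x = inner ℂ v x • u) :
    cNumericalRange c R =
      {z | dist z ((cBar H c ⟨0, pos_of_two_le hk⟩ : ℂ) * inner ℂ v u) +
          dist z ((cTilde H c ⟨k - 1, sub_one_lt_of_two_le hk⟩ : ℂ) * inner ℂ v u) ≤
        (cBar H c ⟨0, pos_of_two_le hk⟩ - cTilde H c ⟨k - 1, sub_one_lt_of_two_le hk⟩) * (‖u‖ * ‖v‖)} := by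
  have hval {n : ℕ} (c' : Fin n → ℝ) (e : Fin n → H) :
      ∑ j, (c' j : ℂ) * inner ℂ (e j) (R (e j)) =
        ∑ j, (c' j : ℂ) * (inner ℂ v (e j) * inner ℂ (e j) u) := by
    simp only [hR, inner_smul_right]
  have hlt : cTilde H c ⟨k - 1, sub_one_lt_of_two_le hk⟩ < cBar H c ⟨0, pos_of_two_le hk⟩ := cTilde_lt_cBar hk hc hne
  refine Set.Subset.antisymm ?_ ?_
  · rintro _ ⟨e, he, rfl⟩
    rw [hval]
    simp only [Set.mem_ofPred_eq, dist_eq_norm]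
    exact norm_sub_add_norm_sub_le he (cTilde_le_apply hk hc) (apply_le_cBar hk hc) hlt.le
      (cTilde_nonpos_and_cBar_nonneg_or_complete hk he) u v
  · intro z hz
    obtain ⟨n, c', a, b, hn, ha, hb, hsub, -⟩ := exists_extended_weights hk hdim hc
    set M := cBar H c ⟨0, pos_of_two_le hk⟩
    set m := cTilde H c ⟨k - 1, sub_one_lt_of_two_le hk⟩
    set t : ℂ := inner ℂ v u with ht
    have hMm : 0 < M - m := sub_pos.2 hlt
    have hMm' : (M - m : ℂ) ≠ 0 := by exact_mod_cast hMm.ne'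
    have hnMm : ‖(M - m : ℂ)‖ = M - m := by
      rw [← Complex.ofReal_sub, Complex.norm_real, Real.norm_of_nonneg hMm.le]
    simp only [Set.mem_ofPred_eq, dist_eq_norm] at hz
    have hab : a ≠ b := by rintro rfl; exact hlt.ne (hb.symm.trans ha)
    have h2 : (2 : Cardinal) ≤ Module.rank ℂ H := le_trans (by exact_mod_cast hk) hdim
    -- The vectors e and f contribute w and t - w, as u lies in their span; w solves M w + m (t - w)
    -- = z.
    obtain ⟨e, f, he, hf, hef, hue, hw⟩ := exists_orthonormal_pair_rankOne_value h2 hu hv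
      (w := (z - m * t) / (M - m)) (by
        rw [← ht]
        have : (z - m * t) / (M - m) - t = (z - M * t) / (M - m) := by
          rw [div_sub' hMm']; congr 1; ring
        rw [this, norm_div, norm_div, hnMm, ← add_div, div_le_iff₀ hMm]
        linarith)
    obtain ⟨g, hg, hga, hgb⟩ := exists_orthonormal_extension_pair (ι := Fin n) (by simpa using hn)
      hab he hf hef
    refine hsub R ⟨g, hg, ?_⟩
    have hzero (j : Fin n) (hj : j ≠ a ∧ j ≠ b) :
        (c' j : ℂ) * (inner ℂ v (g j) * inner ℂ (g j) u) = 0 := by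
      rw [hue, ← hga, ← hgb, inner_add_right, inner_smul_right, inner_smul_right, hg.2 hj.1,
        hg.2 hj.2]
      ring
    rw [hval, Fintype.sum_eq_add a b hab hzero, hga, hgb, ha, hb, hw]
    have htf : t = inner ℂ v e * inner ℂ e u + inner ℂ v f * inner ℂ f u := by
      rw [ht]
      conv_lhs => rw [hue]
      rw [inner_add_right, inner_smul_right, inner_smul_right]
      ring
    rw [hw] at htf
    have hf' : inner ℂ v f * inner ℂ f u = t - (z - m * t) / (M - m) := by
      linear_combination -htf
    rw [hf']
    linear_combination -div_mul_cancel₀ (z - m * t) hMm'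

/-- The foci are (M - m)|t| apart and the major axis is (M - m)‖u‖‖v‖, so equality in Cauchy–Schwarz
separates the two shapes. -/
theorem isEllipticalDisk_or_isLineSegment_of_rankOne (hk : 2 ≤ k)
    (hdim : (k : Cardinal) ≤ Module.rank ℂ H)
    (hc : Antitone c) (hne : ∃ i j, c i ≠ c j) {R : H →L[ℂ] H} {u v : H} (hu : u ≠ 0) (hv : v ≠ 0)
    (hR : ∀ x, R x = inner ℂ v x • u) :
    IsEllipticalDisk (cNumericalRange c R) ((cBar H c ⟨0, pos_of_two_le hk⟩ : ℂ) * inner ℂ v u)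
        ((cTilde H c ⟨k - 1, sub_one_lt_of_two_le hk⟩ : ℂ) * inner ℂ v u) ∨
      IsLineSegment (cNumericalRange c R) ((cBar H c ⟨0, pos_of_two_le hk⟩ : ℂ) * inner ℂ v u)
        ((cTilde H c ⟨k - 1, sub_one_lt_of_two_le hk⟩ : ℂ) * inner ℂ v u) := by
  rw [cNumericalRange_rankOne hk hdim hc hne hu hv hR]
  have hlt : cTilde H c ⟨k - 1, sub_one_lt_of_two_le hk⟩ < cBar H c ⟨0, pos_of_two_le hk⟩ := cTilde_lt_cBar hk hc hne
  set M := cBar H c ⟨0, pos_of_two_le hk⟩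
  set m := cTilde H c ⟨k - 1, sub_one_lt_of_two_le hk⟩
  set t : ℂ := inner ℂ v u with ht
  have hMm : 0 < M - m := sub_pos.2 hlt
  have hdist : dist ((M : ℂ) * t) (m * t) = (M - m) * ‖t‖ := by
    rw [dist_eq_norm, ← sub_mul, norm_mul, ← Complex.ofReal_sub, Complex.norm_real,
      Real.norm_of_nonneg hMm.le]
  have hle : ‖t‖ ≤ ‖u‖ * ‖v‖ := by rw [mul_comm]; exact norm_inner_le_norm v u
  have hr : 0 < ‖u‖ * ‖v‖ := mul_pos (norm_pos_iff.2 hu) (norm_pos_iff.2 hv)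
  rcases hle.lt_or_eq with h | h
  · refine Or.inl ⟨(M - m) * (‖u‖ * ‖v‖) / 2, ?_, ?_⟩
    · rw [hdist, mul_div_cancel₀ _ two_ne_zero]
      exact mul_lt_mul_of_pos_left h hMm
    · rw [mul_div_cancel₀ _ two_ne_zero]
  · refine Or.inr ⟨?_, ?_⟩
    · rw [← dist_pos, hdist, h]
      positivity
    · ext z
      rw [← h, ← hdist, Set.mem_ofPred_eq, mem_segment_iff_wbtw, ← dist_add_dist_eq_iff,
        dist_comm z (M * t)]
      exact ⟨fun hz => le_antisymm hz (dist_triangle _ _ _), fun hz => hz.le⟩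

end Weights

/-! ### Plane geometry of disks and segments -/

section Plane

/-- A point in the open elliptical disk stays in the closed disk after a small move. -/
theorem exists_pos_add_smul_mem {p q z d : ℂ} {a : ℝ} (h : dist z p + dist z q < 2 * a) :
    ∃ ε : ℝ, 0 < ε ∧ dist (z + ε • d) p + dist (z + ε • d) q ≤ 2 * a := by
  set r := 2 * a - (dist z p + dist z q) with hr
  have hr0 : 0 < r := sub_pos.2 h
  have hd : 0 < 2 * (‖d‖ + 1) := by positivity
  refine ⟨r / (2 * (‖d‖ + 1)), by positivity, ?_⟩
  set ε := r / (2 * (‖d‖ + 1)) with hε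
  have hε0 : 0 < ε := by positivity
  have hmove : dist (z + ε • d) z = ε * ‖d‖ := by
    rw [dist_eq_norm, add_sub_cancel_left, norm_smul, Real.norm_of_nonneg hε0.le]
  have h1 := dist_triangle (z + ε • d) z p
  have h2 := dist_triangle (z + ε • d) z q
  have h3 : ε * (2 * (‖d‖ + 1)) = r := div_mul_cancel₀ _ hd.ne'
  rw [hmove] at h1 h2
  linarith

/-- An elliptical disk has no two distinct points on a supporting line. -/
theorem not_isEllipticalDisk_of_edge {S : Set ℂ} {p q : ℂ} (φ : ℂ →ₗ[ℝ] ℝ) {d : ℂ}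
    (hd : 0 < φ d) {N : ℝ} (hS : ∀ z ∈ S, φ z ≤ N) {z₁ z₂ : ℂ} (h₁ : z₁ ∈ S) (h₂ : z₂ ∈ S)
    (hz : z₁ ≠ z₂) (hφ₁ : φ z₁ = N) (hφ₂ : φ z₂ = N) : ¬ IsEllipticalDisk S p q := by
  rintro ⟨a, ha, rfl⟩
  have hlt {z : ℂ} (h : dist z p + dist z q < 2 * a) : φ z < N := by
    obtain ⟨ε, hε, hmem⟩ := exists_pos_add_smul_mem (d := d) h
    have := hS _ hmem
    rw [map_add, map_smul, smul_eq_mul] at this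
    nlinarith [mul_pos hε hd]
  have hp : φ p < N := hlt (by rwa [dist_self, zero_add])
  -- The focus p lies strictly below the supporting line, so z₁ and z₂ are seen from p in different
  -- directions. The triangle inequality is then strict at their midpoint, which would be an
  -- interior point on the line.
  have hray : ¬ SameRay ℝ (z₁ - p) (z₂ - p) := by
    intro h
    have hne {z : ℂ} (hz : φ z = N) : z - p ≠ 0 := by
      intro h0
      rw [sub_eq_zero.1 h0] at hz
      exact hp.ne hz
    obtain ⟨r₁, r₂, hr₁, -, hr⟩ := h.exists_pos (hne hφ₁) (hne hφ₂)
    have hr' := congrArg φ hr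
    rw [map_smul, map_smul, map_sub, map_sub, hφ₁, hφ₂, smul_eq_mul, smul_eq_mul] at hr'
    have hrr : r₁ = r₂ := mul_right_cancel₀ (sub_pos.2 hp).ne' hr'
    rw [← hrr] at hr
    exact hz (sub_left_injective (smul_right_injective ℂ hr₁.ne' hr))
  have hmid (w : ℂ) : dist ((1 / 2 : ℝ) • (z₁ + z₂)) w = ‖(z₁ - w) + (z₂ - w)‖ / 2 := by
    have : (1 / 2 : ℝ) • (z₁ + z₂) - w = (1 / 2 : ℝ) • ((z₁ - w) + (z₂ - w)) := by module
    rw [dist_eq_norm, this, norm_smul, Real.norm_of_nonneg (by norm_num)]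
    ring
  have h := hlt (z := (1 / 2 : ℝ) • (z₁ + z₂)) (by
    have h3 := norm_add_lt_of_not_sameRay hray
    have h4 := norm_add_le (z₁ - q) (z₂ - q)
    simp only [Set.mem_ofPred_eq, dist_eq_norm] at h₁ h₂
    rw [hmid, hmid]
    linarith)
  rw [map_smul, map_add, hφ₁, hφ₂, smul_eq_mul] at h
  linarith

/-- Three points of a line segment are collinear. -/
theorem cross_eq_zero_of_mem_segment {p q z₁ z₂ z₃ : ℂ} (h₁ : z₁ ∈ segment ℝ p q)
    (h₂ : z₂ ∈ segment ℝ p q) (h₃ : z₃ ∈ segment ℝ p q) :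
    (z₂.re - z₁.re) * (z₃.im - z₁.im) - (z₂.im - z₁.im) * (z₃.re - z₁.re) = 0 := by
  rw [segment_eq_image'] at h₁ h₂ h₃
  obtain ⟨r₁, -, rfl⟩ := h₁
  obtain ⟨r₂, -, rfl⟩ := h₂
  obtain ⟨r₃, -, rfl⟩ := h₃
  simp
  ring

/-- Both shapes have two distinct points: the end points of the segment, or a focus and a point near
it. -/
theorem not_isEllipticalDisk_or_isLineSegment_of_subset_singleton {S : Set ℂ} {s : ℂ}
    (hS : S ⊆ {s}) (p q : ℂ) : ¬ (IsEllipticalDisk S p q ∨ IsLineSegment S p q) := by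
  rintro (⟨a, ha, rfl⟩ | ⟨hpq, rfl⟩)
  · have hp : dist p p + dist p q < 2 * a := by rwa [dist_self, zero_add]
    obtain ⟨ε, hε, hmem⟩ := exists_pos_add_smul_mem (d := 1) hp
    have h1 : p = s := hS hp.le
    have h2 : p + ε • (1 : ℂ) = s := hS hmem
    rw [h1, add_eq_left] at h2
    simp [hε.ne'] at h2
  · exact hpq ((hS (left_mem_segment ℝ p q)).trans (hS (right_mem_segment ℝ p q)).symm)

/-- A set in the quadrant `re ≤ M`, `im ≥ m` that contains `M + m i`, `m + M i`, `M + s i` and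
`s + m i`, where `m < M`, is neither an elliptical disk nor a line segment. -/
theorem not_isEllipticalDisk_or_isLineSegment_of_corner {S : Set ℂ} {m M s : ℝ} (hmM : m < M)
    (hre : ∀ z ∈ S, z.re ≤ M) (him : ∀ z ∈ S, m ≤ z.im) (h₁ : (⟨M, m⟩ : ℂ) ∈ S)
    (h₂ : (⟨m, M⟩ : ℂ) ∈ S) (h₃ : (⟨M, s⟩ : ℂ) ∈ S) (h₄ : (⟨s, m⟩ : ℂ) ∈ S) (p q : ℂ) :
    ¬ (IsEllipticalDisk S p q ∨ IsLineSegment S p q) := by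
  rintro (h | ⟨-, rfl⟩)
  -- As m < M, s differs from m or from M, so the right or the bottom edge carries a second point
  -- besides the corner.
  · by_cases hs : s = m
    · refine not_isEllipticalDisk_of_edge (-Complex.imLm) (d := -Complex.I) (N := -m) (by simp)
        (fun z hz => by simpa using him z hz) h₁ h₄ ?_ (by simp) (by simp) h
      intro h
      exact hmM.ne' ((congrArg Complex.re h).trans hs)
    · refine not_isEllipticalDisk_of_edge Complex.reLm (d := 1) (N := M) (by simp)
        (fun z hz => by simpa using hre z hz) h₁ h₃ ?_ (by simp) (by simp) h
      intro h
      exact hs (congrArg Complex.im h).symm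
  · have h3 := cross_eq_zero_of_mem_segment h₁ h₂ h₃
    have h4 := cross_eq_zero_of_mem_segment h₁ h₂ h₄
    simp only [sub_self, mul_zero, zero_sub, sub_zero, neg_eq_zero, mul_eq_zero, sub_eq_zero,
      hmM.ne, hmM.ne', false_or] at h3 h4
    exact hmM.ne (h3.symm.trans h4)

end Plane

/-! ### The diagonal operator with eigenvalues 1 and i -/

section TwoPoint

variable {k : ℕ} {c : Fin k → ℝ}

/-- The diagonal operator with eigenvalues `1`, `i` has a `c`-numerical range of the wrong shape
if the dimension is at least three. -/
theorem not_isEllipticalDisk_or_isLineSegment_of_diagonal (hk : 2 ≤ k)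
    (hdim : (k : Cardinal) ≤ Module.rank ℂ H)
    (hc : Antitone c) (hne : ∃ i j, c i ≠ c j) (h3 : ¬ (Module.rank ℂ H = (2 : ℕ) ∧ k = 2))
    {T : H →L[ℂ] H} {e f : H} (he : ‖e‖ = 1) (hf : ‖f‖ = 1) (hef : inner ℂ e f = 0)
    (hT : ∀ x, T x = inner ℂ e x • e + (Complex.I * inner ℂ f x) • f) (p q : ℂ) :
    ¬ (IsEllipticalDisk (cNumericalRange c T) p q ∨ IsLineSegment (cNumericalRange c T) p q) := by
  have hlt : cTilde H c ⟨k - 1, sub_one_lt_of_two_le hk⟩ < cBar H c ⟨0, pos_of_two_le hk⟩ := cTilde_lt_cBar hk hc hne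
  have hval {n : ℕ} (c' : Fin n → ℝ) (g : Fin n → H) :
      ∑ j, (c' j : ℂ) * inner ℂ (g j) (T (g j)) =
        ∑ j, (c' j : ℂ) * (inner ℂ e (g j) * inner ℂ (g j) e) +
          Complex.I * ∑ j, (c' j : ℂ) * (inner ℂ f (g j) * inner ℂ (g j) f) := by
    rw [Finset.mul_sum, ← Finset.sum_add_distrib]
    refine Finset.sum_congr rfl fun j _ => ?_
    rw [hT, inner_add_right, inner_smul_right, inner_smul_right]
    ring
  have hreal (g : Fin k → H) (hg : Orthonormal ℂ g) {x : H} (hx : ‖x‖ = 1) :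
      ∃ r : ℝ, cTilde H c ⟨k - 1, sub_one_lt_of_two_le hk⟩ ≤ r ∧ r ≤ cBar H c ⟨0, pos_of_two_le hk⟩ ∧
        ∑ j, (c j : ℂ) * (inner ℂ x (g j) * inner ℂ (g j) x) = r := by
    have hsum : ∑ j, (c j : ℂ) * (inner ℂ x (g j) * inner ℂ (g j) x) =
        ((∑ j, c j * ‖inner ℂ (g j) x‖ ^ 2 : ℝ) : ℂ) := by
      push_cast
      refine Finset.sum_congr rfl fun j _ => ?_
      rw [← inner_conj_symm x (g j), mul_comm (starRingEnd ℂ _), Complex.mul_conj,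
        Complex.normSq_eq_norm_sq]
      push_cast
      rfl
    refine ⟨_, ?_, ?_, hsum⟩
    all_goals
      -- With u = v = x of norm one the ellipse degenerates: |r - M| + |r - m| ≤ M - m forces r into
      -- [m, M].
      have h := norm_sub_add_norm_sub_le hg (cTilde_le_apply hk hc) (apply_le_cBar hk hc) hlt.le
        (cTilde_nonpos_and_cBar_nonneg_or_complete hk hg) x x
      rw [hsum, inner_self_eq_norm_sq_to_K, hx] at h
      simp only [RCLike.ofReal_one, one_pow, mul_one, ← Complex.ofReal_sub, Complex.norm_real,
        Real.norm_eq_abs] at h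
      have h1 := abs_le.1 (le_refl |∑ j, c j * ‖inner ℂ (g j) x‖ ^ 2 - cBar H c ⟨0, pos_of_two_le hk⟩|)
      have h2 := abs_le.1
        (le_refl |∑ j, c j * ‖inner ℂ (g j) x‖ ^ 2 - cTilde H c ⟨k - 1, sub_one_lt_of_two_le hk⟩|)
      linarith
  obtain ⟨n, c', a, b, hn, ha, hb, hsub, hn3⟩ := exists_extended_weights hk hdim hc
  have hn3 : 3 ≤ n := hn3.resolve_left h3
  have hab : a ≠ b := by rintro rfl; exact hlt.ne (hb.symm.trans ha)
  -- A third weight, equal to neither extreme index, supplies the extra points on the two edges.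
  obtain ⟨j, hja, hjb⟩ : ∃ j, j ≠ a ∧ j ≠ b := by
    obtain ⟨j, hj⟩ := Finset.exists_mem_notMem_of_card_lt_card
      (s := {a, b}) (t := (Finset.univ : Finset (Fin n)))
      ((Finset.card_le_two).trans_lt (by rw [Finset.card_univ, Fintype.card_fin]; exact hn3))
    exact ⟨j, by simpa using hj⟩
  have hmem {i l : Fin n} (hil : i ≠ l) : (⟨c' i, c' l⟩ : ℂ) ∈ cNumericalRange c T := by
    obtain ⟨g, hg, rfl, rfl⟩ := exists_orthonormal_extension_pair (ι := Fin n) (by simpa using hn)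
      hil he hf hef
    refine hsub T ⟨g, hg, ?_⟩
    have hsingle (i : Fin n) :
        ∑ j, (c' j : ℂ) * (inner ℂ (g i) (g j) * inner ℂ (g j) (g i)) = c' i := by
      rw [Fintype.sum_eq_single i]
      · simp [inner_self_eq_norm_sq_to_K, hg.1 i]
      · intro l hl
        rw [hg.2 hl]
        ring
    rw [hval, hsingle, hsingle, mul_comm, Complex.mk_eq_add_mul_I]
  have hS (z) (hz : z ∈ cNumericalRange c T) :
      z.re ≤ cBar H c ⟨0, pos_of_two_le hk⟩ ∧ cTilde H c ⟨k - 1, sub_one_lt_of_two_le hk⟩ ≤ z.im := by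
    obtain ⟨g, hg, rfl⟩ := hz
    obtain ⟨r₁, -, hr₁, h₁⟩ := hreal g hg he
    obtain ⟨r₂, hr₂, -, h₂⟩ := hreal g hg hf
    rw [hval, h₁, h₂]
    simpa using ⟨hr₁, hr₂⟩
  refine not_isEllipticalDisk_or_isLineSegment_of_corner hlt (s := c' j) (fun z hz => (hS z hz).1)
    (fun z hz => (hS z hz).2) ?_ ?_ ?_ ?_ p q
  · rw [← ha, ← hb]; exact hmem hab
  · rw [← ha, ← hb]; exact hmem hab.symm
  · rw [← ha]; exact hmem hja.symm
  · rw [← hb]; exact hmem hjb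

end TwoPoint

/-! ### Reduction of the equivalence to these operators -/

/-- In dimension two an orthonormal pair gives the identity. -/
theorem eq_sum_of_rank_eq_two (h : Module.rank ℂ H = (2 : ℕ)) {e f : H} (he : ‖e‖ = 1)
    (hf : ‖f‖ = 1) (hef : inner ℂ e f = 0) (x : H) : inner ℂ e x • e + inner ℂ f x • f = x := by
  obtain ⟨g, hg, rfl, rfl⟩ := exists_orthonormal_extension_pair (ι := Fin 2) (by simp [h])
    (zero_ne_one) he hf hef
  rw [← sub_eq_zero, ← neg_eq_zero, neg_sub]
  refine eq_zero_of_orthonormal_of_rank_eq h hg _ fun j => ?_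
  have := hg.inner_right_fintype (fun i => inner ℂ (g i) x) j
  rw [Fin.sum_univ_two] at this
  rw [inner_sub_right, this, sub_self]

theorem cNumericalRange_one_subset {k : ℕ} (c : Fin k → ℝ) :
    cNumericalRange c (1 : H →L[ℂ] H) ⊆ {∑ j, (c j : ℂ)} := by
  rintro _ ⟨g, hg, rfl⟩
  refine Finset.sum_congr rfl fun j _ => ?_
  simp [inner_self_eq_norm_sq_to_K, hg.1 j]

/-- A bounded operator with values in a line is of the form `x ↦ ⟪v, x⟫ u`. -/
theorem exists_rankOne_of_forall_mem_span [CompleteSpace H] {R : H →L[ℂ] H} {u : H} (hu : u ≠ 0)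
    (h : ∀ x, R x ∈ Submodule.span ℂ {u}) : ∃ v, ∀ x, R x = inner ℂ v x • u := by
  have hu0 : (‖u‖ : ℂ) ^ 2 ≠ 0 := pow_ne_zero _ (by exact_mod_cast norm_ne_zero_iff.2 hu)
  refine ⟨((‖u‖ : ℂ) ^ 2)⁻¹ • ContinuousLinearMap.adjoint R u, fun x => ?_⟩
  obtain ⟨l, hl⟩ := Submodule.mem_span_singleton.1 (h x)
  have huu : inner ℂ u u = (‖u‖ : ℂ) ^ 2 := inner_self_eq_norm_sq_to_K u
  rw [inner_smul_left, ContinuousLinearMap.adjoint_inner_left, ← hl, inner_smul_right, huu,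
    map_inv₀, map_pow, Complex.conj_ofReal, mul_comm l, inv_mul_cancel_left₀ hu0]

theorem two_le_rank_range {A : H →L[ℂ] H} (hA : A ≠ 0)
    (h1 : LinearMap.rank (A : H →ₗ[ℂ] H) ≠ 1) :
    (2 : Cardinal) ≤ Module.rank ℂ (LinearMap.range (A : H →ₗ[ℂ] H)) := by
  by_contra h
  obtain ⟨n, hn⟩ := Cardinal.lt_aleph0.1 ((not_le.1 h).trans (Cardinal.natCast_lt_aleph0 (n := 2)))
  rw [LinearMap.rank, hn] at h1
  rw [hn] at h
  have hn2 : ¬ 2 ≤ n := fun h' => h (by exact_mod_cast h')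
  have hn1 : n ≠ 1 := fun h' => h1 (by exact_mod_cast h')
  have hn0 : n = 0 := by omega
  rw [hn0, Nat.cast_zero, Submodule.rank_eq_zero, LinearMap.range_eq_bot] at hn
  exact hA (ContinuousLinearMap.coe_injective hn)

end CNumRange

theorem lemma3p6 {H : Type*} [NormedAddCommGroup H] [InnerProductSpace ℂ H] [CompleteSpace H]
    (k : ℕ) (hk : 2 ≤ k) (hdim : (k : Cardinal) ≤ Module.rank ℂ H)
    (c : Fin k → ℝ) (hc : Antitone c) (hne : ∃ i j, c i ≠ c j)
    (A : H →L[ℂ] H) (hA : A ≠ 0) :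
    LinearMap.rank (A : H →ₗ[ℂ] H) = 1 ↔
      ∀ B : H →L[ℂ] H, A * B ≠ 0 →
        ∃ t : ℂ,
          CNumRange.IsEllipticalDisk (CNumRange.cNumericalRange c (A * B))
              ((CNumRange.cBar H c ⟨0, by omega⟩ : ℂ) * t)
              ((CNumRange.cTilde H c ⟨k - 1, by omega⟩ : ℂ) * t) ∨
            CNumRange.IsLineSegment (CNumRange.cNumericalRange c (A * B))
              ((CNumRange.cBar H c ⟨0, by omega⟩ : ℂ) * t)
              ((CNumRange.cTilde H c ⟨k - 1, by omega⟩ : ℂ) * t) := by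
  constructor
  · intro hrank B hAB
    obtain ⟨u, -, hu, hspan⟩ := rank_submodule_eq_one_iff _ |>.1 hrank
    obtain ⟨v, hv⟩ := CNumRange.exists_rankOne_of_forall_mem_span (R := A * B) hu
      fun x => hspan ⟨B x, rfl⟩
    have hv0 : v ≠ 0 := by
      rintro rfl
      exact hAB (ContinuousLinearMap.ext fun x => by rw [hv, inner_zero_left, zero_smul]; rfl)
    exact ⟨_, CNumRange.isEllipticalDisk_or_isLineSegment_of_rankOne hk hdim hc hne hu hv0 hv⟩
  · intro h
    by_contra h1
    obtain ⟨⟨e, y₁, hy₁⟩, ⟨f, y₂, hy₂⟩, he, hf, hef⟩ :=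
      CNumRange.exists_orthonormal_pair (CNumRange.two_le_rank_range hA h1)
    rw [Submodule.coe_norm] at he hf
    rw [Submodule.coe_inner] at hef
    simp only [ContinuousLinearMap.coe_coe] at he hf hef hy₁ hy₂
    have key (l : ℂ) : ∃ B : H →L[ℂ] H, A * B ≠ 0 ∧
        ∀ x, (A * B) x = inner ℂ e x • e + (l * inner ℂ f x) • f := by
      -- The vectors y₁, y₂ are preimages of e, f under A.
      let B : H →L[ℂ] H := (innerSL ℂ e).smulRight y₁ + l • (innerSL ℂ f).smulRight y₂
      have hB (x : H) : (A * B) x = inner ℂ e x • e + (l * inner ℂ f x) • f := by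
        simp [B, hy₁, hy₂, smul_smul]
      refine ⟨B, fun h0 => ?_, hB⟩
      have h2 := hB e
      rw [h0, inner_eq_zero_symm.1 hef, mul_zero, zero_smul, add_zero,
        inner_self_eq_norm_sq_to_K, he] at h2
      have he0 : e = 0 := by simpa using h2.symm
      rw [he0, norm_zero] at he
      exact zero_ne_one he
    -- In this case there is no third weight, and the eigenvalues 1, i would give a segment; the
    -- identity is used instead.
    by_cases h2 : Module.rank ℂ H = (2 : ℕ) ∧ k = 2
    · obtain ⟨B, hB0, hB⟩ := key 1
      have hB1 : A * B = 1 := ContinuousLinearMap.ext fun x => by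
        rw [hB, one_mul, CNumRange.eq_sum_of_rank_eq_two h2.1 he hf hef]
        rfl
      obtain ⟨t, ht⟩ := h B hB0
      rw [hB1] at ht
      exact CNumRange.not_isEllipticalDisk_or_isLineSegment_of_subset_singleton
        (CNumRange.cNumericalRange_one_subset c) _ _ ht
    · obtain ⟨B, hB0, hB⟩ := key Complex.I
      obtain ⟨t, ht⟩ := h B hB0
      exact CNumRange.not_isEllipticalDisk_or_isLineSegment_of_diagonal hk hdim hc hne h2 he hf hef
        hB _ _ ht
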